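/- Let $R$ be a commutative ring. A partitioned permutation of $[d]=\{1,\dots,d\}$ is a pair $(\mathcal A,\alpha)$ of a set partition $\mathcal A$ of $[d]$ and a permutation $\alpha\in S(d)$ such that every cycle of $\alpha$ is contained in a block of $\mathcal A$; $PS(d)$ is the set of these and $PS=\bigcup_{d\ge 0}PS(d)$. Let $\mathbf 0_\alpha$ be the partition of $[d]$ into supports of cycles of $\alpha$, and $\mathbf 1_d$ the one-block partition. The colength is $|(\mathcal A,\alpha)|=2(d-\#\mathcal A)-(d-\#\mathbf 0_\alpha)$. Put $(\mathcal A,\alpha)\cdot(\mathcal B,\beta)=(\mathcal A\vee\mathcal B,\alpha\circ\beta)$ if $|(\mathcal A,\alpha)|+|(\mathcal B,\beta)|=|(\mathcal A\vee\mathcal B,\alpha\circ\beta)|$, and $0$ otherwise. The convolution of two functions on $PS$ with values in a commutative ring is $$(f_1*f_2)(\mathcal C,\gamma)=\sum_{(\mathcal A,\alpha)\cdot(\mathcal B,\beta)=(\mathcal C,\gamma)}f_1(\mathcal A,\alpha)f_2(\mathcal B,\beta),$$ and $\zeta(\mathcal A,\alpha)=1$ if $\mathcal A=\mathbf 0_\alpha$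 and $0$ otherwise. A function $f$ on $PS$ is multiplicative if $f(\mathbf 1_d,\sigma)$ depends only on the conjugacy class of $\sigma\in S(d)$ for every $d\geq 0$, and $f(\mathcal A,\alpha)=\prod_{A\in\mathcal A}f(\mathbf 1_{\#A},\alpha_{|A})$ for all $(\mathcal A,\alpha)\in PS$. Let $\phi,\phi',\phi^\vee,\phi'^\vee\colon PS\to R$ be functions such that ${}^\flat\phi=\phi+\hbar\phi'$ and ${}^\flat\phi^\vee=\phi^\vee+\hbar\phi'^\vee$, with values in the ring of dual numbers $R'=R[\![\hbar]\!]/(\hbar^2)$, are multiplicative, and suppose that ${}^\flat\phi=\zeta*{}^\flat\phi^\vee$. Introduce the genus $0$ and genus $\frac12$ one-point series $$G_{0,1}(X)=1+\sum_{k>0}\phi(\mathbf 1_k,(1\,2\cdots k))X^k,\qquad G_{\frac12,1}(X)=\sum_{k>0}\phi'(\mathbf 1_k,(1\,2\cdots k))X^k,$$ and likewise $G^\vee_{0,1}(w)$ and $G^\vee_{\frac12,1}(w)$ from $\phi^\vee$ and $\phi'^\vee$. Under the substitution $$X=\frac{w}{G^\vee_{0,1}(w)},\qquad P^\vee(w)=\frac{\mathrm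 d\ln w}{\mathrm d\ln X},$$ the following identities of formal series in $w$ hold: $$G_{0,1}(X)=G^\vee_{0,1}(w),\qquad G_{\frac12,1}(X)=P^\vee(w)\,G^\vee_{\frac12,1}(w).$$ The second one also holds in the equivalent form, as an identity between formal differentials in $w$, $$G_{\frac12,1}(X)\,\frac{\mathrm dX}{X}=G^\vee_{\frac12,1}(w)\,\frac{\mathrm dw}{w}.$$ (These are the functional relations known between the generating series of moments and of free cumulants in infinitesimal freeness.) -/

import Mathlib

open scoped PowerSeries

/-! ### Partitioned permutations -/

/-- A partitioned permutation of `d` elements: a set partition of `Fin d` (as an equivalence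
relation; the blocks are its classes, and `≤`, `⊔` are refinement and merging) and a permutation
each of whose cycles is contained in a block. -/
@[ext]
structure PartitionedPerm (d : ℕ) where
  part : Setoid (Fin d)
  perm : Equiv.Perm (Fin d)
  cycles_le : Equiv.Perm.SameCycle.setoid perm ≤ part

namespace PartitionedPerm

theorem rel_apply {d : ℕ} (p : PartitionedPerm d) (x : Fin d) : p.part x (p.perm x) :=
  p.cycles_le ⟨1, by simp⟩

noncomputable instance (d : ℕ) : Fintype (PartitionedPerm d) :=
  haveI : Finite (Setoid (Fin d)) :=
    Finite.of_injective (fun s : Setoid (Fin d) => (s : Fin d → Fin d → Prop))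
      (fun _ _ h => Setoid.ext fun a b => iff_of_eq (congrFun (congrFun h a) b))
  haveI : Finite (PartitionedPerm d) :=
    Finite.of_injective (fun p : PartitionedPerm d => (p.part, p.perm))
      (fun _ _ h => PartitionedPerm.ext (congrArg Prod.fst h) (congrArg Prod.snd h))
  Fintype.ofFinite _

/-- The partitioned permutation `(1_d, σ)` with the one-block partition (no block if `d = 0`). -/
def full {d : ℕ} (σ : Equiv.Perm (Fin d)) : PartitionedPerm d := ⟨⊤, σ, le_top⟩

/-- The colength `2 (d - #blocks) - (d - #cycles)`. -/
noncomputable def colength {d : ℕ} (p : PartitionedPerm d) : ℤ :=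
  2 * ((d : ℤ) - Nat.card (Quotient p.part)) -
    ((d : ℤ) - Nat.card (Quotient (Equiv.Perm.SameCycle.setoid p.perm)))

/-- Merging of the partitions and composition of the permutations. -/
def extMul {d : ℕ} (p q : PartitionedPerm d) : PartitionedPerm d where
  part := p.part ⊔ q.part
  perm := p.perm * q.perm
  cycles_le := by
    have step : ∀ x, (p.part ⊔ q.part) x ((p.perm * q.perm) x) := fun x =>
      (p.part ⊔ q.part).trans
        ((le_sup_right : q.part ≤ p.part ⊔ q.part) (q.rel_apply x))
        ((le_sup_left : p.part ≤ p.part ⊔ q.part) (p.rel_apply (q.perm x)))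
    rintro x y ⟨i, rfl⟩
    induction i using Int.induction_on with
    | zero => exact (p.part ⊔ q.part).refl _
    | succ i ih =>
      rw [add_comm, zpow_add, zpow_one, Equiv.Perm.mul_apply]
      exact (p.part ⊔ q.part).trans ih (step _)
    | pred i ih =>
      refine (p.part ⊔ q.part).trans ih ((p.part ⊔ q.part).symm ?_)
      have h := step (((p.perm * q.perm) ^ (-(i : ℤ) - 1)) x)
      rwa [← Equiv.Perm.mul_apply, ← zpow_one_add, add_sub_cancel] at h

open Classical in
/-- The product of partitioned permutations; `none` is the absorbing element `0`. -/
noncomputable def mul {d : ℕ} (p q : PartitionedPerm d) : Option (PartitionedPerm d) :=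
  if p.colength + q.colength = (p.extMul q).colength then some (p.extMul q) else none

/-- The restriction of the permutation to a block, transported to `Fin m` (with `m` the size of the
block) by some bijection. -/
noncomputable def restrict {d : ℕ} (p : PartitionedPerm d) (A : Quotient p.part) :
    Equiv.Perm (Fin (Nat.card {x : Fin d // Quotient.mk p.part x = A})) :=
  (Finite.equivFin {x : Fin d // Quotient.mk p.part x = A}).permCongr
    (p.perm.subtypePerm fun x => by
      rw [(Quotient.sound (p.rel_apply x) :
        Quotient.mk p.part x = Quotient.mk p.part (p.perm x))])

end PartitionedPerm

/-- Functions on the set of all partitioned permutations, of any number `d ≥ 0` of elements. -/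
abbrev PSFun (S : Type*) : Type _ := ∀ d : ℕ, PartitionedPerm d → S

namespace PSFun

open Classical in
/-- The zeta function: `1` if the blocks are exactly the supports of the cycles, `0` otherwise. -/
noncomputable def zeta (S : Type*) [CommRing S] : PSFun S := fun _ p =>
  if p.part = Equiv.Perm.SameCycle.setoid p.perm then 1 else 0

open Classical in
/-- The convolution: `(f * g)(c)` is the sum of `f a * g b` over the factorisations `a · b = c`. -/
noncomputable def conv {S : Type*} [CommRing S] (f g : PSFun S) : PSFun S := fun d c =>
  ∑ ab : PartitionedPerm d × PartitionedPerm d with ab.1.mul ab.2 = some c, f d ab.1 * g d ab.2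

open Classical in
/-- Multiplicative functions. By the first property, the choice of bijections in `restrict` has
no influence on the second one. -/
structure IsMultiplicative {S : Type*} [CommRing S] (f : PSFun S) : Prop where
  conj : ∀ (d : ℕ) (σ τ : Equiv.Perm (Fin d)), IsConj σ τ →
    f d (PartitionedPerm.full σ) = f d (PartitionedPerm.full τ)
  prod : ∀ (d : ℕ) (p : PartitionedPerm d),
    f d p = ∏ A : Quotient p.part, f _ (PartitionedPerm.full (p.restrict A))

/-- The function `φ + ħ φ'` with values in the dual numbers `R⟦ħ⟧ / (ħ²)`. -/
def flat {R : Type*} [CommRing R] (φ φ' : PSFun R) : PSFun (DualNumber R) := fun d p =>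
  TrivSqZeroExt.inl (φ d p) + TrivSqZeroExt.inr (φ' d p)

/-- The genus `0` one-point series `1 + ∑_{k > 0} φ(1_k, (1 2 ⋯ k)) X^k`. -/
noncomputable def genusZeroSeries {R : Type*} [CommRing R] (φ : PSFun R) : R⟦X⟧ :=
  PowerSeries.mk fun k => if k = 0 then 1 else φ k (PartitionedPerm.full (finRotate k))

/-- The genus `1/2` one-point series `∑_{k > 0} φ'(1_k, (1 2 ⋯ k)) X^k`. -/
noncomputable def genusHalfSeries {R : Type*} [CommRing R] (φ' : PSFun R) : R⟦X⟧ :=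
  PowerSeries.mk fun k => if k = 0 then 0 else φ' k (PartitionedPerm.full (finRotate k))

end PSFun

/-! ### The change of variable -/

/-- The series `X(w) = w / G(w)`, for `G` with constant term `1`. -/
noncomputable def changeVar {R : Type*} [CommRing R] (G : R⟦X⟧) : R⟦X⟧ :=
  PowerSeries.X * PowerSeries.invOfUnit G 1

/-- The series `d ln w / d ln X = (X(w) / w) / (dX / dw)`, where `X(w) = w / G(w)` and `G` has
constant term `1`. -/
noncomputable def logDerivRatio {R : Type*} [CommRing R] (G : R⟦X⟧) : R⟦X⟧ :=
  PowerSeries.invOfUnit G 1 *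
    PowerSeries.invOfUnit (PowerSeries.derivative R (changeVar G)) 1

/-- The logarithmic differential `du / u` of a series `u(w)` that is invertible as a Laurent series
in `w`. A differential `f(w) dw` is represented by its coefficient `f(w)`. -/
noncomputable def dlog {R : Type*} [CommRing R] (u : R⟦X⟧) : LaurentSeries R :=
  ((PowerSeries.derivative R u : R⟦X⟧) : LaurentSeries R) * Ring.inverse (u : LaurentSeries R)

section Checks

variable {R : Type*} [CommRing R]

theorem PSFun.constantCoeff_genusZeroSeries (φ : PSFun R) :
    PowerSeries.constantCoeff φ.genusZeroSeries = 1 := by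
  simp [PSFun.genusZeroSeries, ← PowerSeries.coeff_zero_eq_constantCoeff_apply]

theorem changeVar_mul (G : R⟦X⟧) (hG : PowerSeries.constantCoeff G = 1) :
    changeVar G * G = PowerSeries.X := by
  rw [changeVar, mul_assoc, mul_comm _ G, PowerSeries.mul_invOfUnit G 1 (by simpa using hG),
    mul_one]

theorem hasSubst_changeVar (G : R⟦X⟧) : PowerSeries.HasSubst (changeVar G) :=
  PowerSeries.HasSubst.of_constantCoeff_zero' (by
    rw [changeVar, map_mul, PowerSeries.constantCoeff_X, zero_mul])

theorem constantCoeff_derivative_changeVar (G : R⟦X⟧) :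
    PowerSeries.constantCoeff (PowerSeries.derivative R (changeVar G)) = 1 := by
  rw [← PowerSeries.coeff_zero_eq_constantCoeff_apply, PowerSeries.coeff_derivative, changeVar,
    PowerSeries.coeff_succ_X_mul]
  simp

theorem isUnit_coe_X : IsUnit ((PowerSeries.X : R⟦X⟧) : LaurentSeries R) := by
  refine IsUnit.of_mul_eq_one (HahnSeries.single (-1 : ℤ) (1 : R)) ?_
  simp

theorem isUnit_coe_changeVar (G : R⟦X⟧) (hG : PowerSeries.constantCoeff G = 1) :
    IsUnit ((changeVar G : R⟦X⟧) : LaurentSeries R) := by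
  refine isUnit_of_mul_isUnit_left (y := (G : LaurentSeries R)) ?_
  rw [← PowerSeries.coe_mul, changeVar_mul G hG]
  exact isUnit_coe_X

/-- `logDerivRatio G` is the quotient of `dw / w` by `dX / X`. -/
theorem logDerivRatio_mul_dlog (G : R⟦X⟧) (hG : PowerSeries.constantCoeff G = 1) :
    (logDerivRatio G : LaurentSeries R) * dlog (changeVar G) = dlog PowerSeries.X := by
  have h1 : PowerSeries.X * logDerivRatio G * PowerSeries.derivative R (changeVar G) =
      changeVar G := by
    have h := PowerSeries.mul_invOfUnit (PowerSeries.derivative R (changeVar G)) 1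
      (by simpa using constantCoeff_derivative_changeVar G)
    rw [logDerivRatio, ← mul_assoc, mul_assoc, mul_comm _ (PowerSeries.derivative R _), h, mul_one,
      changeVar]
  have h2 := congrArg (fun f : R⟦X⟧ => (f : LaurentSeries R)) h1
  simp only [PowerSeries.coe_mul] at h2
  have h3 := Ring.mul_inverse_cancel _ (isUnit_coe_changeVar G hG)
  have h4 := Ring.mul_inverse_cancel _ (isUnit_coe_X (R := R))
  apply (isUnit_coe_X (R := R)).mul_left_cancel
  rw [dlog, dlog, PowerSeries.derivative_X, PowerSeries.coe_one, one_mul, h4, ← mul_assoc,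
    ← mul_assoc, h2, h3]

end Checks

/-!
The coefficients of the genus `0` series of `ζ * f` are sums of products of values of `f` over the
permutations on a geodesic from the identity to a full cycle, that is, over the noncrossing
partitions. Building the permutations by the insertion of one point at a time turns this sum into
the recursion `F_s = κ_s + X F_0 F_{s+1}`, where `s` is the weight of a marked point. It forces
`F_s(w / C(w)) = ∑ₙ κ_{s+n} wⁿ` for `C(w) = ∑ₙ κ_n wⁿ`, and `s = 0` is the genus `0` relation, over
any commutative ring. Over the dual numbers, the `ħ`-part of the same relation is, by Taylor's
formula, the genus `1/2` relation.
-/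

namespace MomentCumulant

/-! ### Equivalence relations -/

section Setoid

variable {V : Type*}

/-- The functions that are constant on the classes of an equivalence relation; this space turns
numbers of classes into dimensions. -/
def constOn (r : Setoid V) : Submodule ℚ (V → ℚ) :=
  LinearMap.range (LinearMap.funLeft ℚ ℚ (Quotient.mk r))

theorem mem_constOn {r : Setoid V} {f : V → ℚ} : f ∈ constOn r ↔ r ≤ Setoid.ker f := by
  constructor
  · rintro ⟨g, rfl⟩ x y h
    exact congrArg g (Quotient.sound h)
  · exact fun h => ⟨Quotient.lift f fun _ _ hab => h hab, rfl⟩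

theorem finrank_constOn [Finite V] (r : Setoid V) :
    Module.finrank ℚ (constOn r) = Nat.card (Quotient r) := by
  have := Fintype.ofFinite (Quotient r)
  rw [constOn, LinearMap.finrank_range_of_inj
    (LinearMap.funLeft_injective_of_surjective _ _ _ Quotient.mk_surjective),
    Module.finrank_fintype_fun_eq_card, Nat.card_eq_fintype_card]

theorem card_quotient_add_card_quotient_le [Finite V] (r s : Setoid V) :
    Nat.card (Quotient r) + Nat.card (Quotient s) ≤ Nat.card V + Nat.card (Quotient (r ⊔ s)) := by
  have := Fintype.ofFinite V
  have inf_le : constOn r ⊓ constOn s ≤ constOn (r ⊔ s) := by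
    rintro f ⟨hr, hs⟩
    exact mem_constOn.2 (sup_le (mem_constOn.1 hr) (mem_constOn.1 hs))
  have finrank_add := Submodule.finrank_sup_add_finrank_inf_eq (constOn r) (constOn s)
  have finrank_inf := Submodule.finrank_mono inf_le
  have finrank_sup := Submodule.finrank_le (constOn r ⊔ constOn s)
  simp only [finrank_constOn, Module.finrank_fintype_fun_eq_card,
    ← Nat.card_eq_fintype_card] at finrank_add finrank_inf finrank_sup
  omega

theorem eq_of_le_of_card_quotient_le [Finite V] {r s : Setoid V} (h : r ≤ s)
    (hc : Nat.card (Quotient r) ≤ Nat.card (Quotient s)) : r = s := by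
  have surj : Function.Surjective (Quotient.map id fun _ _ hab => h hab :
      Quotient r → Quotient s) :=
    Quotient.ind fun x => ⟨Quotient.mk r x, rfl⟩
  exact le_antisymm h fun x y hxy => Quotient.exact <| (surj.bijective_of_nat_card_le hc).1 <|
    show Quotient.mk s x = Quotient.mk s y from Quotient.sound hxy

end Setoid

/-! ### Cycles of permutations -/

section Cycles

open Equiv Equiv.Perm

variable {V W S M : Type*}

theorem sameCycle_setoid_le {σ : Perm V} {r : Setoid V} (h : ∀ x, r x (σ x)) :
    SameCycle.setoid σ ≤ r := by
  rintro x y ⟨i, rfl⟩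
  induction i using Int.induction_on with
  | zero => exact r.refl _
  | succ i ih =>
    rw [add_comm, zpow_one_add, mul_apply]
    exact r.trans ih (h _)
  | pred i ih =>
    refine r.trans ih (r.symm ?_)
    have step := h ((σ ^ (-(i : ℤ) - 1)) x)
    rwa [← mul_apply, ← zpow_one_add, add_sub_cancel] at step

theorem sameCycle_map {σ : Perm V} {τ : Perm W} {f : W → V}
    (h : ∀ u, SameCycle σ (f u) (f (τ u))) {u v : W} (huv : SameCycle τ u v) :
    SameCycle σ (f u) (f v) :=
  sameCycle_setoid_le (r := (SameCycle.setoid σ).comap f) h huv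

theorem sameCycle_apply_self (σ : Perm V) (x : V) : SameCycle σ x (σ x) := ⟨1, by simp⟩

theorem sameCycle_setoid_mul_le (σ τ : Perm V) :
    SameCycle.setoid (σ * τ) ≤ SameCycle.setoid σ ⊔ SameCycle.setoid τ :=
  sameCycle_setoid_le fun x => (SameCycle.setoid σ ⊔ SameCycle.setoid τ).trans
    ((le_sup_right : _ ≤ SameCycle.setoid σ ⊔ SameCycle.setoid τ) (sameCycle_apply_self τ x))
    ((le_sup_left : _ ≤ SameCycle.setoid σ ⊔ SameCycle.setoid τ) (sameCycle_apply_self σ (τ x)))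

theorem sameCycle_permCongr (e : V ≃ W) {σ : Perm V} (x y : W) :
    SameCycle (e.permCongr σ) x y ↔ SameCycle σ (e.symm x) (e.symm y) := by
  refine ⟨sameCycle_map fun u => by simpa using sameCycle_apply_self σ _, fun h => ?_⟩
  have h' : SameCycle (e.permCongr σ) (e (e.symm x)) (e (e.symm y)) :=
    sameCycle_map (fun u => by simpa using sameCycle_apply_self (e.permCongr σ) (e u)) h
  simpa using h'

theorem isConj_of_sameCycle [Finite V] {σ τ : Perm V}
    (hσ : ∀ x y, σ.SameCycle x y) (hτ : ∀ x y, τ.SameCycle x y) : IsConj σ τ := by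
  classical
  have := Fintype.ofFinite V
  rcases subsingleton_or_nontrivial V with _ | _
  · rw [Subsingleton.elim σ τ]
  · have apply_ne {ρ : Perm V} (hρ : ∀ x y, ρ.SameCycle x y) (x) : ρ x ≠ x := fun hx => by
      obtain ⟨y, hy⟩ := exists_ne x
      exact hy ((hρ x y).eq_of_left hx).symm
    have isCycle {ρ : Perm V} (hρ : ∀ x y, ρ.SameCycle x y) : ρ.IsCycle :=
      have ⟨x, _⟩ := exists_pair_ne V
      ⟨x, apply_ne hρ x, fun y _ => hρ x y⟩
    have support_eq {ρ : Perm V} (hρ : ∀ x y, ρ.SameCycle x y) : ρ.support = Finset.univ :=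
      Finset.eq_univ_of_forall fun x => Perm.mem_support.2 (apply_ne hρ x)
    rw [(isCycle hσ).isConj_iff (isCycle hτ), support_eq hσ, support_eq hτ]

theorem sameCycle_finRotate {d : ℕ} (x y : Fin d) : (finRotate d).SameCycle x y := by
  match d with
  | 0 => exact x.elim0
  | 1 => rw [Subsingleton.elim x y]
  | m + 2 =>
    have moves : ∀ z, finRotate (m + 2) z ≠ z := fun z =>
      Perm.mem_support.1 (support_finRotate (n := m) ▸ Finset.mem_univ z)
    exact isCycle_finRotate.sameCycle (moves x) (moves y)

theorem optionCongr_mul (σ τ : Perm V) : optionCongr (σ * τ) = optionCongr σ * optionCongr τ := by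
  ext1 x
  cases x <;> simp

theorem optionCongr_inv (σ : Perm V) : optionCongr σ⁻¹ = (optionCongr σ)⁻¹ := rfl

theorem sameCycle_optionCongr {σ : Perm V} {a b : V} :
    SameCycle (optionCongr σ) (some a) (some b) ↔ SameCycle σ a b := by
  refine ⟨fun h => ?_, sameCycle_map fun u => sameCycle_apply_self (optionCongr σ) (some u)⟩
  refine sameCycle_map (f := fun u => u.getD a) (fun u => ?_) h
  cases u with
  | none => exact SameCycle.refl σ a
  | some u => exact sameCycle_apply_self σ u

theorem not_sameCycle_optionCongr {σ : Perm V} {b : V} :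
    ¬ SameCycle (optionCongr σ) none (some b) := fun h =>
  nomatch h.eq_of_left (show optionCongr σ none = none by simp)

theorem insert_apply_some [DecidableEq V] {σ : Perm V} {x u : V} (hu : σ u ≠ x) :
    (swap none (some x) * optionCongr σ) (some u) = some (σ u) := by
  simpa using swap_apply_of_ne_of_ne (Option.some_ne_none _) (by simpa using hu)

theorem sameCycle_insert_iff [DecidableEq V] (σ : Perm V) (x : V) (u v : Option V) :
    SameCycle (swap none (some x) * optionCongr σ) u v ↔ SameCycle σ (u.getD x) (v.getD x) := by
  set τ := swap none (some x) * optionCongr σ with hτ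
  constructor
  · refine sameCycle_map (f := fun u : Option V => u.getD x) fun u => ?_
    rcases u with _ | u
    · simp [hτ, SameCycle.refl]
    · by_cases hu : σ u = x
      · simpa [hτ, hu] using sameCycle_apply_self σ u
      · simpa [hτ, insert_apply_some hu] using sameCycle_apply_self σ u
  · have step : ∀ u, SameCycle τ (some u) (some (σ u)) := fun u => by
      by_cases hu : σ u = x
      · exact ⟨2, show τ (τ (some u)) = _ by simp [hτ, hu]⟩
      · exact ⟨1, by simp [hτ, insert_apply_some hu]⟩
    have getD : ∀ u : Option V, SameCycle τ u (some (u.getD x)) := by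
      rintro (_ | u)
      · exact ⟨1, by simp [hτ]⟩
      · exact SameCycle.refl _ _
    exact fun h => (getD u).trans ((sameCycle_map step h).trans (getD v).symm)

variable [Fintype V] [Fintype W]

open Classical in
/-- The cycle of a permutation through a point, as a finite set; a fixed point is a cycle. -/
noncomputable def cycle (σ : Perm V) (x : V) : Finset V := Finset.univ.filter (SameCycle σ x)

open Classical in
/-- The cycles of a permutation, as finite sets; fixed points are included. -/
noncomputable def cycles (σ : Perm V) : Finset (Finset V) := Finset.univ.image (cycle σ)

@[simp]
theorem mem_cycle {σ : Perm V} {x y : V} : y ∈ cycle σ x ↔ SameCycle σ x y := by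
  simp [cycle]

@[simp]
theorem mem_cycles {σ : Perm V} {c : Finset V} : c ∈ cycles σ ↔ ∃ x, cycle σ x = c := by
  simp [cycles]

open Classical in
/-- The cycles of a permutation that avoid a point. -/
noncomputable def offCycles (σ : Perm V) (x : V) : Finset (Finset V) :=
  (cycles σ).filter (x ∉ ·)

theorem mem_offCycles {σ : Perm V} {x : V} {c : Finset V} :
    c ∈ offCycles σ x ↔ ∃ y, ¬ SameCycle σ x y ∧ cycle σ y = c := by
  simp only [offCycles, Finset.mem_filter, mem_cycles]
  constructor
  · rintro ⟨⟨y, rfl⟩, h⟩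
    exact ⟨y, fun h' => h (mem_cycle.2 h'.symm), rfl⟩
  · rintro ⟨y, h, rfl⟩
    exact ⟨⟨y, rfl⟩, fun h' => h (mem_cycle.1 h').symm⟩

theorem cycle_eq_cycle_iff {σ : Perm V} {x y : V} : cycle σ x = cycle σ y ↔ SameCycle σ x y := by
  refine ⟨fun h => mem_cycle.1 (h ▸ mem_cycle.2 (SameCycle.refl σ y)), fun h => ?_⟩
  ext z
  simp only [mem_cycle]
  exact ⟨h.symm.trans, h.trans⟩

theorem mem_cycle_self (σ : Perm V) (x : V) : x ∈ cycle σ x := mem_cycle.2 (SameCycle.refl σ x)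

theorem isCycleOn_cycle (σ : Perm V) (x : V) : σ.IsCycleOn (cycle σ x : Set V) := by
  refine ⟨⟨fun y hy => ?_, σ.injective.injOn, fun y hy => ⟨σ⁻¹ y, ?_, by simp⟩⟩,
    fun y hy z hz => ?_⟩
  · simpa using hy
  · simpa using hy
  · exact (mem_cycle.1 hy).symm.trans (mem_cycle.1 hz)

theorem injOn_pow_apply (σ : Perm V) (x : V) :
    Set.InjOn (fun n => (σ ^ n) x) (Finset.range (cycle σ x).card : Set ℕ) := fun a ha b hb h =>
  (((isCycleOn_cycle σ x).pow_apply_eq_pow_apply (mem_cycle_self σ x)).1 h).eq_of_lt_of_lt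
    (by simpa using ha) (by simpa using hb)

theorem cycle_eq_image_of_walk [DecidableEq V] {τ : Perm V} {f : ℕ → V} {k : ℕ} (hk : 0 < k)
    (hstep : ∀ n, n + 1 < k → τ (f n) = f (n + 1)) (hclose : τ (f (k - 1)) = f 0) :
    cycle τ (f 0) = (Finset.range k).image f := by
  have pow_eq : ∀ n < k, (τ ^ n) (f 0) = f n := by
    intro n
    induction n with
    | zero => simp
    | succ n ih =>
      intro hn
      rw [pow_succ', mul_apply, ih (by omega), hstep n hn]
  have stays : ∀ n : ℕ, ∃ i < k, f i = (τ ^ n) (f 0) := by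
    intro n
    induction n with
    | zero => exact ⟨0, hk, rfl⟩
    | succ n ih =>
      obtain ⟨i, hi, hfi⟩ := ih
      rw [pow_succ', mul_apply, ← hfi]
      rcases lt_or_ge (i + 1) k with h | h
      · exact ⟨i + 1, h, (hstep i h).symm⟩
      · exact ⟨0, hk, by rw [← hclose, show k - 1 = i by omega]⟩
  ext y
  simp only [mem_cycle, Finset.mem_image, Finset.mem_range]
  constructor
  · intro h
    obtain ⟨n, -, rfl⟩ := h.exists_pow_eq'
    exact stays n
  · rintro ⟨n, hn, rfl⟩
    exact ⟨n, by rw [zpow_natCast, pow_eq n hn]⟩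

theorem card_cycle_pos (σ : Perm V) (x : V) : 0 < (cycle σ x).card :=
  Finset.card_pos.2 ⟨x, mem_cycle_self σ x⟩

theorem apply_pow_pred_card_cycle (σ : Perm V) (x : V) :
    σ ((σ ^ ((cycle σ x).card - 1)) x) = x := by
  rw [← mul_apply, ← pow_succ', Nat.sub_add_cancel (card_cycle_pos σ x),
    (isCycleOn_cycle σ x).pow_card_apply (mem_cycle_self σ x)]

theorem cycle_eq_image_pow [DecidableEq V] (σ : Perm V) (x : V) :
    cycle σ x = (Finset.range (cycle σ x).card).image fun n => (σ ^ n) x := by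
  refine cycle_eq_image_of_walk (f := fun n => (σ ^ n) x) (card_cycle_pos σ x) (fun n _ => ?_)
    (apply_pow_pred_card_cycle σ x)
  rw [pow_succ', mul_apply]

theorem sum_cycle [AddCommMonoid M] (σ : Perm V) (x : V) (g : V → M) :
    ∑ v ∈ cycle σ x, g v = ∑ n ∈ Finset.range (cycle σ x).card, g ((σ ^ n) x) := by
  classical
  conv_lhs => rw [cycle_eq_image_pow]
  exact Finset.sum_image (injOn_pow_apply σ x)

theorem notMem_offCycles {σ : Perm V} {x y : V} {c : Finset V} (hy : SameCycle σ x y)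
    (hc : y ∈ c) : c ∉ offCycles σ x := fun h => by
  obtain ⟨z, hz, rfl⟩ := mem_offCycles.1 h
  exact hz (hy.trans (mem_cycle.1 hc).symm)

theorem cycles_eq_cons (σ : Perm V) (x : V) :
    cycles σ = (offCycles σ x).cons (cycle σ x)
      (notMem_offCycles (SameCycle.refl σ x) (mem_cycle_self σ x)) := by
  ext c
  rw [Finset.mem_cons, mem_offCycles, mem_cycles]
  constructor
  · rintro ⟨y, rfl⟩
    by_cases hy : SameCycle σ x y
    · exact Or.inl (cycle_eq_cycle_iff.2 hy.symm)
    · exact Or.inr ⟨y, hy, rfl⟩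
  · rintro (rfl | ⟨y, -, rfl⟩)
    exacts [⟨x, rfl⟩, ⟨y, rfl⟩]

section SwapMul

variable [DecidableEq V] {σ : Perm V} {x : V}

theorem cycle_swap_mul_of_not_sameCycle {j y : V} (hj : SameCycle σ x j)
    (hy : ¬ SameCycle σ x y) : cycle (swap x j * σ) y = cycle σ y := by
  have step : ∀ n : ℕ, (swap x j * σ) ((σ ^ n) y) = (σ ^ (n + 1)) y := fun n => by
    have not_mem : ¬ SameCycle σ x ((σ ^ (n + 1)) y) := by simpa using hy
    rw [mul_apply, ← mul_apply σ, ← pow_succ']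
    refine swap_apply_of_ne_of_ne (fun h => not_mem ?_) fun h => not_mem ?_
    · rw [h]
    · rwa [h]
  conv_rhs => rw [cycle_eq_image_pow]
  refine cycle_eq_image_of_walk (f := fun n => (σ ^ n) y) (card_cycle_pos σ y)
    (fun n _ => step n) ?_
  rw [step, pow_succ', mul_apply, apply_pow_pred_card_cycle, pow_zero, one_apply]

variable {i : ℕ} (hi : i < (cycle σ x).card)

include hi

theorem swap_pow_mul_apply_pow {n : ℕ} (hn : n + 1 < (cycle σ x).card) (hni : n + 1 ≠ i) :
    (swap x ((σ ^ i) x) * σ) ((σ ^ n) x) = (σ ^ (n + 1)) x := by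
  have ne : ∀ a < (cycle σ x).card, n + 1 ≠ a → (σ ^ (n + 1)) x ≠ (σ ^ a) x := fun a ha hna h =>
    hna (injOn_pow_apply σ x (by simpa using hn) (by simpa using ha) h)
  rw [mul_apply, ← mul_apply σ, ← pow_succ']
  exact swap_apply_of_ne_of_ne (by simpa using ne 0 (by omega) (by omega)) (ne i hi hni)

theorem cycle_swap_pow_mul_left (hi0 : 0 < i) :
    cycle (swap x ((σ ^ i) x) * σ) x = (Finset.range i).image fun n => (σ ^ n) x := by
  refine cycle_eq_image_of_walk (f := fun n => (σ ^ n) x) hi0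
    (fun n hn => swap_pow_mul_apply_pow hi (by omega) (by omega)) ?_
  rw [mul_apply, ← mul_apply σ, ← pow_succ', Nat.sub_add_cancel hi0, swap_apply_right, pow_zero,
    one_apply]

theorem cycle_swap_pow_mul_right :
    cycle (swap x ((σ ^ i) x) * σ) ((σ ^ i) x) =
      (Finset.Ico i (cycle σ x).card).image fun n => (σ ^ n) x := by
  have walk := cycle_eq_image_of_walk (τ := swap x ((σ ^ i) x) * σ)
    (f := fun n => (σ ^ (i + n)) x) (k := (cycle σ x).card - i) (by omega)
    (fun n hn => swap_pow_mul_apply_pow hi (by omega) (by omega)) (by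
      rw [mul_apply, show i + ((cycle σ x).card - i - 1) = (cycle σ x).card - 1 by omega,
        apply_pow_pred_card_cycle, swap_apply_left, add_zero])
  rw [add_zero] at walk
  rw [walk, ← Nat.add_sub_cancel' hi.le, Nat.add_sub_cancel_left]
  conv_rhs => rw [← Nat.add_zero i, Nat.add_assoc, Nat.zero_add]
  rw [← Finset.image_add_left_Ico, ← Finset.range_eq_Ico, Finset.image_image]
  rfl

theorem not_sameCycle_swap_pow_mul (hi0 : 0 < i) :
    ¬ SameCycle (swap x ((σ ^ i) x) * σ) x ((σ ^ i) x) := by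
  rw [← mem_cycle, cycle_swap_pow_mul_left hi hi0, Finset.mem_image]
  rintro ⟨n, hn, h⟩
  have hni : n < i := Finset.mem_range.1 hn
  exact hni.ne (injOn_pow_apply σ x (by simpa using hni.trans hi) (by simpa using hi) h)

theorem sameCycle_swap_pow_mul_or_iff (hi0 : 0 < i) {y : V} :
    SameCycle (swap x ((σ ^ i) x) * σ) x y ∨ SameCycle (swap x ((σ ^ i) x) * σ) ((σ ^ i) x) y ↔
      SameCycle σ x y := by
  simp only [← mem_cycle]
  rw [cycle_swap_pow_mul_left hi hi0, cycle_swap_pow_mul_right hi, ← Finset.mem_union,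
    ← Finset.image_union, Finset.range_eq_Ico, Finset.Ico_union_Ico_eq_Ico i.zero_le hi.le,
    ← Finset.range_eq_Ico, ← cycle_eq_image_pow]

theorem offCycles_swap_pow_mul (hi0 : 0 < i) :
    offCycles (swap x ((σ ^ i) x) * σ) x =
      (offCycles σ x).cons (cycle (swap x ((σ ^ i) x) * σ) ((σ ^ i) x))
        (notMem_offCycles ⟨i, by simp⟩ (mem_cycle_self _ _)) := by
  have same_pow : SameCycle σ x ((σ ^ i) x) := ⟨i, by simp⟩
  ext c
  rw [Finset.mem_cons, mem_offCycles, mem_offCycles]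
  constructor
  · rintro ⟨y, hy, rfl⟩
    by_cases h : SameCycle (swap x ((σ ^ i) x) * σ) ((σ ^ i) x) y
    · exact Or.inl (cycle_eq_cycle_iff.2 h.symm)
    · have not_same : ¬ SameCycle σ x y := by
        rw [← sameCycle_swap_pow_mul_or_iff hi hi0, not_or]
        exact ⟨hy, h⟩
      exact Or.inr ⟨y, not_same, (cycle_swap_mul_of_not_sameCycle same_pow not_same).symm⟩
  · rintro (rfl | ⟨y, hy, rfl⟩)
    · exact ⟨_, not_sameCycle_swap_pow_mul hi hi0, rfl⟩
    · refine ⟨y, fun h => hy ?_, cycle_swap_mul_of_not_sameCycle same_pow hy⟩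
      exact (sameCycle_swap_pow_mul_or_iff hi hi0).1 (Or.inl h)

theorem card_cycle_swap_pow_mul_left (hi0 : 0 < i) :
    (cycle (swap x ((σ ^ i) x) * σ) x).card = i := by
  rw [cycle_swap_pow_mul_left hi hi0, Finset.card_image_of_injOn, Finset.card_range]
  exact (injOn_pow_apply σ x).mono fun n hn => by simp at hn ⊢; omega

theorem card_cycle_swap_pow_mul_right :
    (cycle (swap x ((σ ^ i) x) * σ) ((σ ^ i) x)).card = (cycle σ x).card - i := by
  rw [cycle_swap_pow_mul_right hi, Finset.card_image_of_injOn, Nat.card_Ico]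
  exact (injOn_pow_apply σ x).mono fun n hn => by simp at hn ⊢; omega

end SwapMul

open Classical in
/-- The product, over the cycles of a permutation, of a function `κ` of the total mass of the
cycle, where the points of the cycle have masses `m`. -/
noncomputable def cycleProd [AddCommMonoid M] [CommMonoid S] (κ : M → S) (m : V → M)
    (σ : Perm V) : S :=
  ∏ c ∈ cycles σ, κ (∑ v ∈ c, m v)

open Classical in
theorem prod_cycles_eq_prod_quotient [CommMonoid S] (g : Finset V → S) (σ : Perm V) :
    ∏ c ∈ cycles σ, g c =
      ∏ A : Quotient (SameCycle.setoid σ), g {v | Quotient.mk (SameCycle.setoid σ) v = A} := by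
  have class_eq : ∀ x, ({v | Quotient.mk (SameCycle.setoid σ) v = Quotient.mk _ x} : Finset V) =
      cycle σ x := fun x => by
    ext y
    simp only [Finset.mem_filter, Finset.mem_univ, true_and, mem_cycle, Quotient.eq]
    exact sameCycle_comm
  symm
  refine Finset.prod_bij (fun A _ => ({v | Quotient.mk _ v = A} : Finset V)) ?_ ?_ ?_
    fun _ _ => rfl
  · exact fun A _ => A.inductionOn fun x => mem_cycles.2 ⟨x, (class_eq x).symm⟩
  · refine fun A _ B _ => Quotient.inductionOn₂ A B fun x y h => ?_
    rw [class_eq, class_eq, cycle_eq_cycle_iff] at h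
    exact Quotient.sound h
  · intro c hc
    obtain ⟨x, rfl⟩ := mem_cycles.1 hc
    exact ⟨Quotient.mk _ x, Finset.mem_univ _, class_eq x⟩

section CycleProd

variable [AddCommMonoid M] [CommMonoid S] (κ : M → S) (m : V → M)

theorem cycleProd_eq_mul_prod_offCycles (σ : Perm V) (x : V) :
    cycleProd κ m σ = κ (∑ v ∈ cycle σ x, m v) * ∏ c ∈ offCycles σ x, κ (∑ v ∈ c, m v) := by
  rw [cycleProd, cycles_eq_cons σ x, Finset.prod_cons]

theorem cycleProd_of_sameCycle_iff [DecidableEq V] {f : W → V} (hf : f.Surjective)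
    {σ : Perm V} {τ : Perm W} (h : ∀ u v, SameCycle τ u v ↔ SameCycle σ (f u) (f v))
    (m : W → M) : cycleProd κ m τ = cycleProd κ (fun v => ∑ w with f w = v, m w) σ := by
  have preimage_cycle : ∀ w, ({u | f u ∈ cycle σ (f w)} : Finset W) = cycle τ w := fun w => by
    ext u
    simp [h]
  symm
  refine Finset.prod_bij (fun c _ => ({w | f w ∈ c} : Finset W)) ?_ ?_ ?_ ?_
  · intro c hc
    obtain ⟨v, rfl⟩ := mem_cycles.1 hc
    obtain ⟨w, rfl⟩ := hf v
    exact mem_cycles.2 ⟨w, (preimage_cycle w).symm⟩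
  · intro c _ c' _ hcc'
    ext v
    obtain ⟨w, rfl⟩ := hf v
    simpa using congrArg (w ∈ ·) hcc'
  · intro c hc
    obtain ⟨w, rfl⟩ := mem_cycles.1 hc
    exact ⟨cycle σ (f w), mem_cycles.2 ⟨f w, rfl⟩, preimage_cycle w⟩
  · intro c _
    rw [← Finset.sum_fiberwise_of_maps_to (s := {w | f w ∈ c}) (t := c) (g := f) (by simp)]
    refine congrArg κ (Finset.sum_congr rfl fun v hv => Finset.sum_congr ?_ fun _ _ => rfl)
    ext w
    simp only [Finset.mem_filter, Finset.mem_univ, true_and]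
    exact ⟨fun hw => ⟨hw ▸ hv, hw⟩, And.right⟩

theorem cycleProd_swap_pow_mul [DecidableEq V] {σ : Perm V} {x : V} {i : ℕ} (hi0 : 0 < i)
    (hi : i < (cycle σ x).card) :
    cycleProd κ m (swap x ((σ ^ i) x) * σ) = κ (∑ v ∈ cycle (swap x ((σ ^ i) x) * σ) x, m v) *
      κ (∑ v ∈ cycle (swap x ((σ ^ i) x) * σ) ((σ ^ i) x), m v) *
        ∏ c ∈ offCycles σ x, κ (∑ v ∈ c, m v) := by
  rw [cycleProd_eq_mul_prod_offCycles κ m _ x, offCycles_swap_pow_mul hi hi0, Finset.prod_cons,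
    ← mul_assoc]

theorem cycleProd_permCongr (e : V ≃ W) (σ : Perm V) (m : W → M) :
    cycleProd κ m (e.permCongr σ) = cycleProd κ (m ∘ e) σ := by
  classical
  rw [cycleProd_of_sameCycle_iff κ e.symm.surjective (sameCycle_permCongr e)]
  congr 1 with v
  have fiber : ({w | e.symm w = v} : Finset W) = {e v} := by
    ext w
    simp [Equiv.symm_apply_eq]
  rw [fiber, Finset.sum_singleton, Function.comp_apply]

theorem cycleProd_insert [DecidableEq V] (σ : Perm V) (x : V) (m : Option V → M) :
    cycleProd κ m (swap none (some x) * optionCongr σ) =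
      cycleProd κ (m ∘ some + Pi.single x (m none)) σ := by
  rw [cycleProd_of_sameCycle_iff κ (fun v => ⟨some v, rfl⟩) (sameCycle_insert_iff σ x)]
  congr 1 with v
  rw [Finset.sum_filter, Fintype.sum_option, add_comm]
  simp [Pi.single_apply, eq_comm (a := v)]

theorem cycleProd_optionCongr (σ : Perm V) (m : Option V → M) :
    cycleProd κ m (optionCongr σ) = κ (m none) * cycleProd κ (m ∘ some) σ := by
  have cycle_none : cycle (optionCongr σ) none = {none} := by
    ext (_ | v) <;> simp [SameCycle.refl, not_sameCycle_optionCongr]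
  have cycle_some : ∀ v, cycle (optionCongr σ) (some v) =
      (cycle σ v).map Function.Embedding.some := fun v => by
    ext (_ | w)
    · simp [sameCycle_comm, not_sameCycle_optionCongr]
    · simp [sameCycle_optionCongr]
  have offCycles_none : offCycles (optionCongr σ) none =
      (cycles σ).map (Finset.mapEmbedding Function.Embedding.some).toEmbedding := by
    ext c
    simp only [mem_offCycles, Option.exists, cycle_some, Finset.mem_map, mem_cycles]
    simp [not_sameCycle_optionCongr, SameCycle.refl]
  rw [cycleProd_eq_mul_prod_offCycles κ m _ none, cycle_none, Finset.sum_singleton,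
    offCycles_none, Finset.prod_map]
  simp [cycleProd]

end CycleProd

end Cycles

section Geodesic

open Equiv Equiv.Perm

variable {V W : Type*}

/-- The number of cycles of a permutation, fixed points included. -/
noncomputable def numCycles (σ : Perm V) : ℕ := Nat.card (Quotient (SameCycle.setoid σ))

/-- Through this identity, the formulas for `cycleProd` count cycles. -/
theorem ofAdd_numCycles [Fintype V] (σ : Perm V) : Multiplicative.ofAdd (numCycles σ) =
    cycleProd (fun _ : ℕ => Multiplicative.ofAdd 1) 0 σ := by
  classical
  rw [cycleProd, prod_cycles_eq_prod_quotient]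
  simp [numCycles, Nat.card_eq_fintype_card, ← ofAdd_nsmul]

theorem numCycles_permCongr (e : V ≃ W) (σ : Perm V) :
    numCycles (e.permCongr σ) = numCycles σ :=
  Nat.card_congr (Quotient.congr e.symm (sameCycle_permCongr e))

theorem numCycles_mul_comm (σ τ : Perm V) : numCycles (σ * τ) = numCycles (τ * σ) := by
  rw [← numCycles_permCongr τ, permCongr_eq_mul, mul_assoc, mul_assoc, mul_inv_cancel, mul_one]

/-- `β` lies on a geodesic from the identity to `γ` in the Cayley graph of the transpositions;
such permutations below a full cycle are the noncrossing partitions. -/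
def IsGeodesic (γ β : Perm V) : Prop :=
  numCycles (γ * β⁻¹) + numCycles β = numCycles γ + Nat.card V

theorem isGeodesic_permCongr (e : V ≃ W) {γ β : Perm V} :
    IsGeodesic (e.permCongr γ) (e.permCongr β) ↔ IsGeodesic γ β := by
  have mul_inv : e.permCongr γ * (e.permCongr β)⁻¹ = e.permCongr (γ * β⁻¹) := by
    simp only [← permCongrHom_coe, map_mul, map_inv]
  rw [IsGeodesic, IsGeodesic, mul_inv, numCycles_permCongr, numCycles_permCongr,
    numCycles_permCongr, Nat.card_congr e]

variable [Finite V]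

theorem numCycles_optionCongr (σ : Perm V) : numCycles (optionCongr σ) = numCycles σ + 1 :=
  Multiplicative.ofAdd.injective <| by
    have := Fintype.ofFinite V
    rw [ofAdd_add, ofAdd_numCycles, ofAdd_numCycles, cycleProd_optionCongr, mul_comm]
    rfl

theorem numCycles_insert [DecidableEq V] (σ : Perm V) (x : V) :
    numCycles (swap none (some x) * optionCongr σ) = numCycles σ :=
  Multiplicative.ofAdd.injective <| by
    have := Fintype.ofFinite V
    rw [ofAdd_numCycles, ofAdd_numCycles, cycleProd_insert, Pi.zero_apply, Pi.single_zero,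
      add_zero]
    rfl

theorem numCycles_swap_mul [DecidableEq V] {σ : Perm V} {x j : V} (h : SameCycle σ x j)
    (hj : j ≠ x) : numCycles (swap x j * σ) = numCycles σ + 1 := by
  have := Fintype.ofFinite V
  obtain ⟨i, hi, rfl⟩ := (isCycleOn_cycle σ x).exists_pow_eq (mem_cycle_self σ x) (mem_cycle.2 h)
  have hi0 : 0 < i := Nat.pos_of_ne_zero fun h0 => hj (by simp [h0])
  apply Multiplicative.ofAdd.injective
  rw [ofAdd_add, ofAdd_numCycles, ofAdd_numCycles, cycleProd_swap_pow_mul _ _ hi0 hi,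
    cycleProd_eq_mul_prod_offCycles _ _ σ x, mul_assoc, mul_comm]

variable {γ β : Perm V}

theorem IsGeodesic.sup_eq (h : IsGeodesic γ β) :
    SameCycle.setoid (γ * β⁻¹) ⊔ SameCycle.setoid β = SameCycle.setoid γ := by
  have rank := card_quotient_add_card_quotient_le (SameCycle.setoid (γ * β⁻¹))
    (SameCycle.setoid β)
  have le := sameCycle_setoid_mul_le (γ * β⁻¹) β
  rw [inv_mul_cancel_right] at le
  refine (eq_of_le_of_card_quotient_le le ?_).symm
  unfold IsGeodesic numCycles at h
  omega

theorem IsGeodesic.sameCycle (h : IsGeodesic γ β) (x : V) : SameCycle γ x (β x) := by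
  have le : SameCycle.setoid β ≤ SameCycle.setoid γ := h.sup_eq ▸ le_sup_right
  exact le (sameCycle_apply_self β x)

theorem isGeodesic_optionCongr : IsGeodesic (optionCongr γ) (optionCongr β) ↔ IsGeodesic γ β := by
  simp only [IsGeodesic, ← optionCongr_inv, ← optionCongr_mul, numCycles_optionCongr,
    Finite.card_option]
  omega

variable [DecidableEq V]

theorem isGeodesic_insert_optionCongr {x : V} :
    IsGeodesic (swap none (some x) * optionCongr γ) (optionCongr β) ↔ IsGeodesic γ β := by
  simp only [IsGeodesic, mul_assoc, ← optionCongr_inv, ← optionCongr_mul, numCycles_optionCongr,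
    numCycles_insert, Finite.card_option]
  omega

theorem isGeodesic_insert_insert {x j : V} (h : SameCycle γ x j) :
    IsGeodesic (swap none (some x) * optionCongr γ) (swap none (some j) * optionCongr β) ↔
      IsGeodesic (swap x j * γ) β := by
  have conj : numCycles (swap none (some x) * optionCongr γ *
      (swap none (some j) * optionCongr β)⁻¹) =
        numCycles (swap none (some j) * swap none (some x) * optionCongr (γ * β⁻¹)) := by
    rw [mul_inv_rev, swap_inv, ← mul_assoc, numCycles_mul_comm, mul_assoc (swap none (some x)),
      ← optionCongr_inv, ← optionCongr_mul, mul_assoc]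
  rw [IsGeodesic, IsGeodesic, conj, numCycles_insert, numCycles_insert, Finite.card_option,
    mul_assoc (swap x j)]
  rcases eq_or_ne j x with rfl | hj
  · rw [swap_mul_self, one_mul, swap_self, ← Perm.one_def, one_mul, one_mul,
      numCycles_optionCongr]
    omega
  · have swap_mul_swap : swap none (some j) * swap none (some x) =
        swap none (some x) * optionCongr (swap x j) := by
      rw [optionCongr_swap, mul_swap_eq_swap_mul (swap none (some x)), swap_apply_right,
        swap_apply_of_ne_of_ne (Option.some_ne_none j) (by simpa using hj)]
    rw [swap_mul_swap, mul_assoc (swap none (some x)), ← optionCongr_mul, numCycles_insert,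
      numCycles_swap_mul h hj]
    omega

end Geodesic

/-! ### Sums over geodesics -/

section GeodesicSum

open Equiv Equiv.Perm

variable {V W S M : Type*}

theorem sum_add_single_of_mem [DecidableEq V] [AddCommMonoid M] {s : Finset V} {x : V}
    (h : x ∈ s) (m : V → M) (a : M) :
    ∑ v ∈ s, (m + Pi.single x a : V → M) v = ∑ v ∈ s, m v + a := by
  simp [Finset.sum_add_distrib, Finset.sum_pi_single', h]

theorem sum_add_single_of_notMem [DecidableEq V] [AddCommMonoid M] {s : Finset V} {x : V}
    (h : x ∉ s) (m : V → M) (a : M) :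
    ∑ v ∈ s, (m + Pi.single x a : V → M) v = ∑ v ∈ s, m v := by
  simp [Finset.sum_add_distrib, Finset.sum_pi_single', h]

variable [Fintype V] [Fintype W] [DecidableEq V] [DecidableEq W]

section

variable [AddCommMonoid M] [CommMonoid S] (κ : M → S) (m : V → M)

theorem prod_offCycles_add_single {σ : Perm V} {x y : V} (h : SameCycle σ x y) (a : M) :
    ∏ c ∈ offCycles σ x, κ (∑ v ∈ c, (m + Pi.single y a : V → M) v) =
      ∏ c ∈ offCycles σ x, κ (∑ v ∈ c, m v) :=
  Finset.prod_congr rfl fun _ hc => congrArg κ <|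
    sum_add_single_of_notMem (fun hy => notMem_offCycles h hy hc) m a

theorem cycleProd_add_single (σ : Perm V) (x : V) (a : M) :
    cycleProd κ (m + Pi.single x a) σ =
      κ (∑ v ∈ cycle σ x, m v + a) * ∏ c ∈ offCycles σ x, κ (∑ v ∈ c, m v) := by
  rw [cycleProd_eq_mul_prod_offCycles κ _ σ x, sum_add_single_of_mem (mem_cycle_self σ x),
    prod_offCycles_add_single κ m (SameCycle.refl σ x)]

theorem cycleProd_add_single_swap_pow_mul {σ : Perm V} {x : V} {i : ℕ} (hi0 : 0 < i)
    (hi : i < (cycle σ x).card) (a : M) :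
    cycleProd κ (m + Pi.single ((σ ^ i) x) a) (swap x ((σ ^ i) x) * σ) =
      κ (∑ v ∈ cycle (swap x ((σ ^ i) x) * σ) x, m v) *
        κ (∑ v ∈ cycle (swap x ((σ ^ i) x) * σ) ((σ ^ i) x), m v + a) *
          ∏ c ∈ offCycles σ x, κ (∑ v ∈ c, m v) := by
  rw [cycleProd_swap_pow_mul κ _ hi0 hi, sum_add_single_of_mem (mem_cycle_self _ _),
    sum_add_single_of_notMem (mt mem_cycle.1 (not_sameCycle_swap_pow_mul hi hi0)),
    prod_offCycles_add_single κ m ⟨i, by simp⟩]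

end

section CommSemiring

variable [CommSemiring S] (κ : ℕ → S)

open Classical in
/-- The sum of `cycleProd` over the permutations on the geodesics from the identity to `γ`. For a
full cycle `γ` and unit masses it is the sum over the noncrossing partitions that expresses a
moment by the free cumulants `κ`. -/
noncomputable def geodesicSum (m : V → ℕ) (γ : Perm V) : S :=
  ∑ β with IsGeodesic γ β, cycleProd κ m β

theorem geodesicSum_permCongr (e : V ≃ W) (m : W → ℕ) (γ : Perm V) :
    geodesicSum κ m (e.permCongr γ) = geodesicSum κ (m ∘ e) γ :=
  (Finset.sum_equiv e.permCongr (by simp [isGeodesic_permCongr])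
    fun β _ => (cycleProd_permCongr κ e β m).symm).symm

theorem sum_perm_option (f : Perm (Option V) → S) :
    ∑ β, f β = ∑ β : Perm V, f (optionCongr β) +
      ∑ j, ∑ β : Perm V, f (swap none (some j) * optionCongr β) := by
  rw [← decomposeOption.symm.sum_comp, Fintype.sum_prod_type, Fintype.sum_option]
  simp only [decomposeOption_symm_apply, swap_self, ← Perm.one_def, one_mul]

theorem geodesicSum_optionCongr (m : Option V → ℕ) (γ : Perm V) :
    geodesicSum κ m (optionCongr γ) = κ (m none) * geodesicSum κ (m ∘ some) γ := by
  classical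
  have not_geodesic (j : V) (β : Perm V) :
      ¬ IsGeodesic (optionCongr γ) (swap none (some j) * optionCongr β) := fun h =>
    not_sameCycle_optionCongr (by simpa using h.sameCycle none)
  simp only [geodesicSum, Finset.sum_filter, sum_perm_option, isGeodesic_optionCongr,
    not_geodesic, if_false, Finset.sum_const_zero, add_zero, Finset.mul_sum, mul_ite, mul_zero,
    cycleProd_optionCongr]

theorem geodesicSum_insert (m : Option V → ℕ) (γ : Perm V) (x : V) :
    geodesicSum κ m (swap none (some x) * optionCongr γ) =
      κ (m none) * geodesicSum κ (m ∘ some) γ +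
        ∑ j ∈ cycle γ x, geodesicSum κ (m ∘ some + Pi.single j (m none)) (swap x j * γ) := by
  classical
  have sameCycle_of_geodesic {j : V} {β : Perm V}
      (h : IsGeodesic (swap none (some x) * optionCongr γ)
        (swap none (some j) * optionCongr β)) : SameCycle γ x j :=
    (sameCycle_insert_iff γ x none (some j)).1 (by simpa using h.sameCycle none)
  simp only [geodesicSum, Finset.sum_filter, sum_perm_option, isGeodesic_insert_optionCongr,
    Finset.mul_sum, mul_ite, mul_zero, cycleProd_optionCongr, cycleProd_insert]
  congr 1
  rw [← Finset.sum_subset (Finset.subset_univ (cycle γ x))]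
  · refine Finset.sum_congr rfl fun j hj => ?_
    simp only [isGeodesic_insert_insert (mem_cycle.1 hj)]
  · refine fun j _ hj => Finset.sum_eq_zero fun β _ => if_neg fun h => ?_
    exact hj (mem_cycle.2 (sameCycle_of_geodesic h))

/-- The coefficient of `X ^ n` in the series determined by `F_s = κ_s + X F_0 F_{s+1}`. For `n > 0`
it is the `n`-th moment for the free cumulants `κ`, except that one marked point counts `s`
additional times in the size of its block. -/
def freeMoment : ℕ → ℕ → S
  | 0, s => κ s
  | n + 1, s => ∑ i : Fin (n + 1), freeMoment i 0 * freeMoment (n - i) (s + 1)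

@[simp]
theorem freeMoment_zero (s : ℕ) : freeMoment κ 0 s = κ s := by
  rw [freeMoment]

theorem freeMoment_succ (n s : ℕ) : freeMoment κ (n + 1) s =
    ∑ i ∈ Finset.range (n + 1), freeMoment κ i 0 * freeMoment κ (n - i) (s + 1) := by
  rw [freeMoment, Finset.sum_range]

variable {κ} (h0 : κ 0 = 1)

include h0

theorem cycleProd_freeMoment_swap_pow_mul {γ : Perm V} {x : V} {i : ℕ} (hi : i < (cycle γ x).card)
    (s : ℕ) :
    cycleProd (freeMoment κ).uncurry ((fun _ => (1, 0)) + Pi.single ((γ ^ i) x) (0, s))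
        (swap x ((γ ^ i) x) * γ) =
      freeMoment κ i 0 * freeMoment κ ((cycle γ x).card - i) s *
        ∏ c ∈ offCycles γ x, freeMoment κ c.card 0 := by
  rcases i.eq_zero_or_pos with rfl | hi0
  · simp [← Perm.one_def, cycleProd_add_single, h0]
  · simp [cycleProd_add_single_swap_pow_mul _ _ hi0 hi, card_cycle_swap_pow_mul_left hi hi0,
      card_cycle_swap_pow_mul_right hi]

/-- Summing over the image of the inserted point is the recursion that defines `freeMoment`. -/
theorem geodesicSum_insert_eq_cycleProd
    (ih : ∀ (σ : Perm V) (e : V → ℕ), (Function.support e).Subsingleton →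
      geodesicSum κ (1 + e) σ = cycleProd (freeMoment κ).uncurry (fun v => (1, e v)) σ)
    (γ : Perm V) (x : V) (s : ℕ) :
    geodesicSum κ (1 + Pi.single none s) (swap none (some x) * optionCongr γ) =
      cycleProd (freeMoment κ).uncurry (fun w => (1, (Pi.single none s : Option V → ℕ) w))
        (swap none (some x) * optionCongr γ) := by
  set L := (cycle γ x).card
  set rest := ∏ c ∈ offCycles γ x, freeMoment κ c.card 0
  have unmarked : geodesicSum κ 1 γ = freeMoment κ L 0 * rest := by
    have := ih γ 0 (by simp)
    simpa [cycleProd_eq_mul_prod_offCycles _ _ γ x] using this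
  have marked (i : ℕ) (hi : i < L) :
      geodesicSum κ (1 + Pi.single ((γ ^ i) x) (1 + s)) (swap x ((γ ^ i) x) * γ) =
        freeMoment κ i 0 * freeMoment κ (L - i) (1 + s) * rest := by
    rw [ih _ _ (Set.subsingleton_singleton.anti Pi.support_single_subset),
      ← cycleProd_freeMoment_swap_pow_mul h0 hi]
    congr 1 with v <;> by_cases h : v = (γ ^ i) x <;> simp [h]
  have comp_some : (1 + Pi.single none s : Option V → ℕ) ∘ some = 1 := by
    ext v
    simp
  have recursion : cycleProd (freeMoment κ).uncurry ((fun _ => (1, 0)) + Pi.single x (1, s)) γ =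
      freeMoment κ (L + 1) s * rest := by
    simp [cycleProd_add_single, L, rest]
  rw [geodesicSum_insert, comp_some, unmarked, sum_cycle, cycleProd_insert]
  simp only [Function.comp_def, Pi.add_apply, Pi.one_apply, Pi.single_eq_same,
    Pi.single_eq_of_ne (Option.some_ne_none _)]
  rw [recursion, freeMoment_succ, Finset.sum_range_succ, Nat.sub_self, freeMoment_zero, add_mul,
    Finset.sum_mul, Finset.sum_congr rfl fun i hi => marked i (Finset.mem_range.1 hi)]
  simp only [add_comm 1 s]
  ring

theorem geodesicSum_option_eq_cycleProd
    (ih : ∀ (σ : Perm V) (e : V → ℕ), (Function.support e).Subsingleton →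
      geodesicSum κ (1 + e) σ = cycleProd (freeMoment κ).uncurry (fun v => (1, e v)) σ)
    (γ : Perm (Option V)) (s : ℕ) :
    geodesicSum κ (1 + Pi.single none s) γ =
      cycleProd (freeMoment κ).uncurry (fun w => (1, (Pi.single none s : Option V → ℕ) w)) γ := by
  obtain ⟨⟨_ | x, σ⟩, rfl⟩ := decomposeOption.symm.surjective γ
  · have unmarked := ih σ 0 (by simp)
    have comp_some : (1 + Pi.single none s : Option V → ℕ) ∘ some = 1 + 0 := by
      ext v
      simp
    rw [decomposeOption_symm_apply, swap_self, ← Perm.one_def, one_mul, geodesicSum_optionCongr,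
      cycleProd_optionCongr, comp_some, unmarked]
    simp [freeMoment_succ, h0, Function.comp_def, add_comm]
  · rw [decomposeOption_symm_apply]
    exact geodesicSum_insert_eq_cycleProd h0 ih σ x s

theorem geodesicSum_eq_cycleProd_freeMoment (γ : Perm V) (e : V → ℕ)
    (he : (Function.support e).Subsingleton) :
    geodesicSum κ (1 + e) γ = cycleProd (freeMoment κ).uncurry (fun v => (1, e v)) γ := by
  induction hn : Fintype.card V generalizing V with
  | zero =>
    have := Fintype.card_eq_zero_iff.1 hn
    simp [geodesicSum, cycleProd, cycles, IsGeodesic, numCycles]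
  | succ n ih =>
    have : Nonempty V := Fintype.card_pos_iff.1 (by omega)
    obtain ⟨x, hx⟩ : ∃ x, Function.support e ⊆ {x} := by
      rcases he.eq_empty_or_singleton with h | ⟨x, h⟩
      · exact ⟨Classical.arbitrary V, by simp [h]⟩
      · exact ⟨x, h.subset⟩
    set f := optionSubtypeNe x
    have comp_f : e ∘ f = Pi.single none (e x) := by
      ext (_ | v)
      · simp [f]
      · simpa [f] using Function.notMem_support.1 fun hv => v.2 (hx hv)
    obtain ⟨γ, rfl⟩ := f.permCongr.surjective γ
    have option_eq := geodesicSum_option_eq_cycleProd h0 (fun σ e he => ih σ e he (by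
      have := Fintype.card_congr f
      rw [Fintype.card_option] at this
      omega)) γ (e x)
    rw [← comp_f] at option_eq
    rwa [geodesicSum_permCongr, cycleProd_permCongr]

end CommSemiring

end GeodesicSum

/-! ### Power series -/

open PowerSeries

section PowerSeries

variable {R : Type*} [CommRing R]

theorem eq_zero_of_X_pow_dvd_imp {ι : Type*} {E : ι → R⟦X⟧}
    (h : ∀ n, (∀ i, X ^ n ∣ E i) → ∀ i, X ^ (n + 1) ∣ E i) (i : ι) : E i = 0 := by
  have dvd (n : ℕ) : ∀ i, X ^ n ∣ E i := by
    induction n with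
    | zero => simp
    | succ n ih => exact h n ih
  ext n
  exact X_pow_dvd_iff.1 (dvd (n + 1) i) n n.lt_succ_self

theorem subst_X_mul_add_C {u : R⟦X⟧} (hu : HasSubst u) (F : R⟦X⟧) (c : R) :
    (X * F + C c).subst u = u * F.subst u + C c := by
  rw [subst_add hu, subst_mul hu, subst_X hu, subst_C]
  rfl

theorem mk_freeMoment_eq (κ : ℕ → R) (s : ℕ) :
    mk (freeMoment κ · s) =
      X * (mk (freeMoment κ · 0) * mk (freeMoment κ · (s + 1))) + C (κ s) := by
  ext (_ | n)
  · simp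
  · rw [map_add, coeff_succ_X_mul, coeff_mul, Finset.Nat.sum_antidiagonal_eq_sum_range_succ_mk]
    simp [freeMoment_succ]

theorem subst_changeVar_mk_freeMoment {κ : ℕ → R} (h0 : κ 0 = 1) (s : ℕ) :
    (mk (freeMoment κ · s)).subst (changeVar (mk κ)) = mk fun n => κ (s + n) := by
  set u := changeVar (mk κ)
  set F : ℕ → R⟦X⟧ := fun s => (mk (freeMoment κ · s)).subst u
  set K : ℕ → R⟦X⟧ := fun s => mk fun n => κ (s + n)
  have hu : HasSubst u := hasSubst_changeVar _
  have u_mul : u * K 0 = X := by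
    simpa [K] using changeVar_mul (mk κ) (by simpa using h0)
  have X_dvd : X ∣ u := Dvd.intro _ rfl
  have F_eq (s : ℕ) : F s = u * (F 0 * F (s + 1)) + C (κ s) := by
    simp only [F]
    conv_lhs => rw [mk_freeMoment_eq]
    rw [subst_X_mul_add_C hu, subst_mul hu]
  have K_eq (s : ℕ) : K s = X * K (s + 1) + C (κ s) := by
    ext (_ | n)
    · simp [K]
    · simp [K, coeff_succ_X_mul, add_assoc, add_comm 1]
  refine sub_eq_zero.1 (eq_zero_of_X_pow_dvd_imp (E := fun s => F s - K s) (fun n ih s => ?_) s)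
  have diff_eq : F s - K s = u * ((F 0 - K 0) * F (s + 1) + K 0 * (F (s + 1) - K (s + 1))) := by
    linear_combination F_eq s - K_eq s + K (s + 1) * u_mul
  rw [diff_eq, pow_succ']
  exact mul_dvd_mul X_dvd (dvd_add ((ih 0).mul_right _) ((ih (s + 1)).mul_left _))

/-- The series `F₀` of a power series `F₀ + ħ F₁` over the dual numbers. -/
noncomputable def fstSeries : (DualNumber R)⟦X⟧ →+* R⟦X⟧ :=
  PowerSeries.map (TrivSqZeroExt.fstHom R R R : DualNumber R →+* R)

/-- The series `F₁` of a power series `F₀ + ħ F₁` over the dual numbers. -/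
noncomputable def sndSeries : (DualNumber R)⟦X⟧ →+ R⟦X⟧ where
  toFun F := mk fun n => (coeff n F).snd
  map_zero' := by ext; simp
  map_add' F G := by ext; simp

@[simp]
theorem coeff_fstSeries (n : ℕ) (F : (DualNumber R)⟦X⟧) :
    coeff n (fstSeries F) = (coeff n F).fst := coeff_map _ _ _

@[simp]
theorem coeff_sndSeries (n : ℕ) (F : (DualNumber R)⟦X⟧) :
    coeff n (sndSeries F) = (coeff n F).snd := by
  simp [sndSeries]

theorem constantCoeff_fstSeries (F : (DualNumber R)⟦X⟧) :
    constantCoeff (fstSeries F) = (constantCoeff F).fst := by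
  rw [← coeff_zero_eq_constantCoeff_apply, coeff_fstSeries, coeff_zero_eq_constantCoeff_apply]

theorem fstSeries_C (c : DualNumber R) : fstSeries (C c) = C c.fst := map_C _ _

theorem fstSeries_X : fstSeries (X : (DualNumber R)⟦X⟧) = X := map_X _

theorem sndSeries_C (c : DualNumber R) : sndSeries (C c) = C c.snd := by
  ext (_ | n) <;> simp [coeff_C]

theorem sndSeries_X : sndSeries (X : (DualNumber R)⟦X⟧) = 0 := by
  ext n
  rcases eq_or_ne n 1 with rfl | h <;> simp [coeff_X, *]

theorem sndSeries_mul (F G : (DualNumber R)⟦X⟧) :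
    sndSeries (F * G) = fstSeries F * sndSeries G + sndSeries F * fstSeries G := by
  ext n
  simp only [coeff_sndSeries, map_add, coeff_mul, coeff_fstSeries, TrivSqZeroExt.snd_sum,
    TrivSqZeroExt.snd_mul, ← Finset.sum_add_distrib, smul_eq_mul, MulOpposite.smul_eq_mul_unop,
    MulOpposite.unop_op]

theorem fstSeries_X_mul_add_C (F : (DualNumber R)⟦X⟧) (c : DualNumber R) :
    fstSeries (X * F + C c) = X * fstSeries F + C c.fst := by
  rw [map_add, map_mul, fstSeries_X, fstSeries_C]

theorem sndSeries_X_mul_add_C (F : (DualNumber R)⟦X⟧) (c : DualNumber R) :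
    sndSeries (X * F + C c) = X * sndSeries F + C c.snd := by
  rw [map_add, sndSeries_mul, sndSeries_X, zero_mul, add_zero, fstSeries_X, sndSeries_C]

theorem fstSeries_subst {u : (DualNumber R)⟦X⟧} (hu : constantCoeff u = 0)
    (F : (DualNumber R)⟦X⟧) : fstSeries (F.subst u) = (fstSeries F).subst (fstSeries u) :=
  map_subst (HasSubst.of_constantCoeff_zero' hu) F

theorem sndSeries_subst {u : (DualNumber R)⟦X⟧} (hu : constantCoeff u = 0)
    (F : (DualNumber R)⟦X⟧) :
    sndSeries (F.subst u) = (sndSeries F).subst (fstSeries u) +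
      sndSeries u * (derivative R (fstSeries F)).subst (fstSeries u) := by
  have hs : HasSubst u := HasSubst.of_constantCoeff_zero' hu
  have constantCoeff_fst : constantCoeff (fstSeries u) = 0 := by
    rw [constantCoeff_fstSeries, hu, TrivSqZeroExt.fst_zero]
  have hs₀ : HasSubst (fstSeries u) := HasSubst.of_constantCoeff_zero' constantCoeff_fst
  set E : (DualNumber R)⟦X⟧ → R⟦X⟧ := fun F => sndSeries (F.subst u) -
    ((sndSeries F).subst (fstSeries u) +
      sndSeries u * (derivative R (fstSeries F)).subst (fstSeries u))
  have E_eq (F : (DualNumber R)⟦X⟧) : ∃ G, E F = fstSeries u * E G := by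
    refine ⟨mk fun n => coeff (n + 1) F, ?_⟩
    conv_lhs => rw [F.eq_X_mul_shift_add_const]
    generalize mk (fun n => coeff (n + 1) F) = G, constantCoeff F = c
    have derivative_eq : derivative R (X * fstSeries G + C c.fst) =
        X * derivative R (fstSeries G) + fstSeries G := by
      rw [map_add, derivative_C, add_zero, Derivation.leibniz, derivative_X, smul_eq_mul,
        smul_eq_mul, mul_one]
    simp only [E]
    rw [subst_X_mul_add_C hs, sndSeries_X_mul_add_C, fstSeries_X_mul_add_C, subst_X_mul_add_C hs₀,
      derivative_eq, subst_add hs₀, subst_mul hs₀, subst_X hs₀, map_add, sndSeries_mul,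
      sndSeries_C, fstSeries_subst hu]
    ring
  refine sub_eq_zero.1 (eq_zero_of_X_pow_dvd_imp (E := E) (fun n ih F => ?_) F)
  obtain ⟨G, hG⟩ := E_eq F
  rw [hG, pow_succ']
  exact mul_dvd_mul (X_dvd_iff.2 constantCoeff_fst) (ih G)

theorem fstSeries_changeVar {G : (DualNumber R)⟦X⟧} (hG : constantCoeff G = 1) :
    fstSeries (changeVar G) = changeVar (fstSeries G) := by
  have hG₀ : constantCoeff (fstSeries G) = 1 := by
    rw [constantCoeff_fstSeries, hG, TrivSqZeroExt.fst_one]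
  have isUnit : IsUnit (fstSeries G) := isUnit_iff_constantCoeff.2 (hG₀ ▸ isUnit_one)
  apply isUnit.mul_right_cancel
  rw [changeVar_mul _ hG₀, ← map_mul, changeVar_mul _ hG, fstSeries_X]

theorem logDerivRatio_mul_derivative_changeVar_mul {G : R⟦X⟧} (hG : constantCoeff G = 1) :
    logDerivRatio G * (derivative R (changeVar G) * G) = 1 := by
  have mul_inv := mul_invOfUnit (derivative R (changeVar G)) 1
    (by simpa using constantCoeff_derivative_changeVar G)
  rw [logDerivRatio]
  linear_combination G * invOfUnit G 1 * mul_inv + mul_invOfUnit G 1 (by simpa using hG)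

theorem constantCoeff_changeVar (G : R⟦X⟧) : constantCoeff (changeVar G) = 0 := by
  simp [changeVar]

section Tangent

variable {F G : (DualNumber R)⟦X⟧} (hG : constantCoeff G = 1) (h : F.subst (changeVar G) = G)

include hG h

theorem fstSeries_subst_changeVar_of_subst_eq :
    (fstSeries F).subst (changeVar (fstSeries G)) = fstSeries G := by
  rw [← fstSeries_changeVar hG, ← fstSeries_subst (constantCoeff_changeVar G), h]

/-- The `ħ`-part of `F(X) = G` is `F₁(X₀) + X₁ F₀'(X₀) = G₁`, where `X₁ = -X₀ G₁ / G₀` is the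
`ħ`-part of `X = w / G` and `F₀'(X₀) = G₀' / X₀'`. -/
theorem sndSeries_subst_changeVar_of_subst_eq :
    (sndSeries F).subst (changeVar (fstSeries G)) =
      logDerivRatio (fstSeries G) * sndSeries G := by
  have hG₀ : constantCoeff (fstSeries G) = 1 := by
    rw [constantCoeff_fstSeries, hG, TrivSqZeroExt.fst_one]
  set u := changeVar (fstSeries G)
  have fst_changeVar : fstSeries (changeVar G) = u := fstSeries_changeVar hG
  have snd_eq : (sndSeries F).subst u +
      sndSeries (changeVar G) * (derivative R (fstSeries F)).subst u = sndSeries G := by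
    rw [← fst_changeVar, ← sndSeries_subst (constantCoeff_changeVar G), h]
  have u_mul : u * fstSeries G = X := changeVar_mul _ hG₀
  have snd_u_mul : u * sndSeries G + sndSeries (changeVar G) * fstSeries G = 0 := by
    rw [← fst_changeVar, ← sndSeries_mul, changeVar_mul _ hG, sndSeries_X]
  have chain : (derivative R (fstSeries F)).subst u * derivative R u =
      derivative R (fstSeries G) := by
    rw [← derivative_subst (hasSubst_changeVar _), fstSeries_subst_changeVar_of_subst_eq hG h]
  have leibniz : u * derivative R (fstSeries G) + fstSeries G * derivative R u = 1 := by
    simpa [Derivation.leibniz] using congrArg (derivative R) u_mul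
  have derivative_mul : derivative R u * fstSeries G * (sndSeries F).subst u = sndSeries G := by
    linear_combination (derivative R u * fstSeries G) * snd_eq -
      derivative R (fstSeries G) * snd_u_mul + sndSeries G * leibniz -
      (sndSeries (changeVar G) * fstSeries G) * chain
  rw [← derivative_mul, ← mul_assoc, logDerivRatio_mul_derivative_changeVar_mul hG₀, one_mul]

end Tangent

end PowerSeries

end MomentCumulant

/-! ### Convolution with the zeta function -/

namespace PartitionedPerm

open Equiv Equiv.Perm MomentCumulant

variable {d : ℕ}

/-- The partitioned permutation `(0_σ, σ)`. -/
def ofPerm (σ : Perm (Fin d)) : PartitionedPerm d := ⟨SameCycle.setoid σ, σ, le_rfl⟩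

theorem full_finRotate (d : ℕ) : full (finRotate d) = ofPerm (finRotate d) :=
  PartitionedPerm.ext (eq_top_iff.2 fun x y _ => sameCycle_finRotate x y).symm rfl

theorem mul_eq_some_iff {p q r : PartitionedPerm d} :
    p.mul q = some r ↔ p.colength + q.colength = r.colength ∧ p.extMul q = r := by
  rw [mul]
  constructor
  · split_ifs with h
    · rintro ⟨⟩
      exact ⟨h, rfl⟩
    · rintro ⟨⟩
  · rintro ⟨h, rfl⟩
    exact if_pos h

theorem ofPerm_mul_eq_some_iff {α γ : Perm (Fin d)} {q : PartitionedPerm d} :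
    (ofPerm α).mul q = some (ofPerm γ) ↔
      q = ofPerm q.perm ∧ α * q.perm = γ ∧ IsGeodesic γ q.perm := by
  have card_block_le : Nat.card (Quotient q.part) ≤
      Nat.card (Quotient (SameCycle.setoid q.perm)) :=
    Nat.card_le_card_of_surjective (Quotient.map id fun _ _ h => q.cycles_le h)
      (Quotient.ind fun x => ⟨Quotient.mk _ x, rfl⟩)
  have card_join := card_quotient_add_card_quotient_le (SameCycle.setoid α) q.part
  rw [mul_eq_some_iff, PartitionedPerm.ext_iff, PartitionedPerm.ext_iff]
  simp only [IsGeodesic, numCycles, colength, extMul, ofPerm, and_true, Nat.card_fin]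
  rw [Nat.card_fin] at card_join
  constructor
  · rintro ⟨colength_eq, join_eq, rfl⟩
    rw [join_eq] at card_join
    have part_eq : SameCycle.setoid q.perm = q.part :=
      eq_of_le_of_card_quotient_le q.cycles_le (by omega)
    rw [part_eq] at colength_eq ⊢
    rw [mul_inv_cancel_right]
    exact ⟨rfl, rfl, by omega⟩
  · rintro ⟨part_eq, rfl, geodesic⟩
    have join_eq := IsGeodesic.sup_eq (γ := α * q.perm) (β := q.perm) (by
      simpa [IsGeodesic, numCycles] using geodesic)
    rw [mul_inv_cancel_right] at geodesic join_eq
    rw [part_eq]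
    exact ⟨by omega, join_eq, rfl⟩

theorem isConj_restrict_ofPerm_finRotate (σ : Perm (Fin d)) (A : Quotient (ofPerm σ).part) :
    IsConj ((ofPerm σ).restrict A) (finRotate _) := by
  refine isConj_of_sameCycle (fun x y => ?_) sameCycle_finRotate
  obtain ⟨x, rfl⟩ := (Finite.equivFin _).surjective x
  obtain ⟨y, rfl⟩ := (Finite.equivFin _).surjective y
  rw [restrict, sameCycle_permCongr, sameCycle_subtypePerm, symm_apply_apply, symm_apply_apply]
  exact Quotient.exact (x.2.trans y.2.symm)

end PartitionedPerm

namespace PSFun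

open Equiv Equiv.Perm PartitionedPerm MomentCumulant

variable {S : Type*} [CommRing S] {d : ℕ}

open Classical in
theorem conv_zeta_ofPerm (f : PSFun S) (γ : Perm (Fin d)) :
    conv (zeta S) f d (ofPerm γ) = ∑ β with IsGeodesic γ β, f d (ofPerm β) := by
  have eq_ofPerm {p : PartitionedPerm d} (h : p.part = SameCycle.setoid p.perm) :
      p = ofPerm p.perm := PartitionedPerm.ext h rfl
  simp only [conv, zeta, ite_mul, one_mul, zero_mul]
  rw [← Finset.sum_filter, Finset.filter_filter]
  refine Finset.sum_bij' (fun ab _ => ab.2.perm) (fun β _ => (ofPerm (γ * β⁻¹), ofPerm β))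
    ?_ ?_ ?_ ?_ ?_
  · rintro ⟨a, b⟩ h
    simp only [Finset.mem_filter, Finset.mem_univ, true_and] at h ⊢
    rw [eq_ofPerm h.2, ofPerm_mul_eq_some_iff] at h
    exact h.1.2.2
  · intro β h
    simp only [Finset.mem_filter, Finset.mem_univ, true_and] at h ⊢
    rw [ofPerm_mul_eq_some_iff]
    exact ⟨⟨rfl, inv_mul_cancel_right γ β, h⟩, rfl⟩
  · rintro ⟨a, b⟩ h
    simp only [Finset.mem_filter, Finset.mem_univ, true_and] at h
    obtain ⟨ab_eq, a_part⟩ := h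
    rw [eq_ofPerm a_part, ofPerm_mul_eq_some_iff] at ab_eq
    refine Prod.ext ?_ ab_eq.1.symm
    change ofPerm (γ * b.perm⁻¹) = a
    rw [← ab_eq.2.1, mul_inv_cancel_right, ← eq_ofPerm a_part]
  · exact fun β _ => rfl
  · rintro ⟨a, b⟩ h
    simp only [Finset.mem_filter, Finset.mem_univ, true_and] at h
    rw [eq_ofPerm h.2, ofPerm_mul_eq_some_iff] at h
    exact congrArg (f d) h.1.1

theorem coeff_genusZeroSeries {n : ℕ} (hn : n ≠ 0) (f : PSFun S) :
    PowerSeries.coeff n f.genusZeroSeries = f n (ofPerm (finRotate n)) := by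
  simp [genusZeroSeries, hn, full_finRotate]

theorem IsMultiplicative.apply_ofPerm {f : PSFun S} (hf : f.IsMultiplicative)
    (σ : Perm (Fin d)) :
    f d (ofPerm σ) = cycleProd (PowerSeries.coeff · f.genusZeroSeries) 1 σ := by
  classical
  rw [hf.prod, cycleProd, prod_cycles_eq_prod_quotient]
  refine Finset.prod_congr (by congr!) fun A _ => ?_
  have card_pos : Nat.card {x // Quotient.mk (ofPerm σ).part x = A} ≠ 0 := by
    obtain ⟨x, rfl⟩ := Quotient.exists_rep A
    have : Nonempty {y // Quotient.mk (ofPerm σ).part y = Quotient.mk _ x} := ⟨⟨x, rfl⟩⟩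
    exact Nat.card_pos.ne'
  rw [hf.conj _ _ _ (isConj_restrict_ofPerm_finRotate σ A), full_finRotate,
    ← coeff_genusZeroSeries card_pos f, Nat.card_eq_fintype_card, Fintype.card_subtype,
    Finset.card_eq_sum_ones]
  rfl

theorem coeff_genusZeroSeries_conv_zeta {f : PSFun S} (hf : f.IsMultiplicative) (n : ℕ) :
    PowerSeries.coeff n (conv (zeta S) f).genusZeroSeries =
      freeMoment (PowerSeries.coeff · f.genusZeroSeries) n 0 := by
  have h0 : PowerSeries.coeff 0 f.genusZeroSeries = 1 := by
    simpa using constantCoeff_genusZeroSeries f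
  rcases n with _ | n
  · simpa [h0] using constantCoeff_genusZeroSeries (conv (zeta S) f)
  · have cycle_eq : cycle (finRotate (n + 1)) 0 = Finset.univ :=
      Finset.eq_univ_of_forall fun y => mem_cycle.2 (sameCycle_finRotate 0 y)
    have offCycles_eq : offCycles (finRotate (n + 1)) 0 = ∅ :=
      Finset.eq_empty_of_forall_notMem fun c hc =>
        have ⟨y, hy, _⟩ := mem_offCycles.1 hc
        hy (sameCycle_finRotate 0 y)
    have geodesicSum_eq := geodesicSum_eq_cycleProd_freeMoment
      (κ := (PowerSeries.coeff · f.genusZeroSeries)) h0 (finRotate (n + 1)) 0 (by simp)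
    rw [cycleProd_eq_mul_prod_offCycles _ _ _ 0, cycle_eq, offCycles_eq] at geodesicSum_eq
    rw [coeff_genusZeroSeries n.succ_ne_zero, conv_zeta_ofPerm]
    simpa [geodesicSum, hf.apply_ofPerm] using geodesicSum_eq

theorem subst_changeVar_genusZeroSeries_conv_zeta {f : PSFun S} (hf : f.IsMultiplicative) :
    (conv (zeta S) f).genusZeroSeries.subst (changeVar f.genusZeroSeries) = f.genusZeroSeries := by
  have h0 : PowerSeries.coeff 0 f.genusZeroSeries = 1 := by
    simpa using constantCoeff_genusZeroSeries f
  have conv_eq : (conv (zeta S) f).genusZeroSeries =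
      .mk (freeMoment (PowerSeries.coeff · f.genusZeroSeries) · 0) :=
    PowerSeries.ext fun n => by rw [coeff_genusZeroSeries_conv_zeta hf, PowerSeries.coeff_mk]
  have mk_eq : PowerSeries.mk (PowerSeries.coeff · f.genusZeroSeries) = f.genusZeroSeries :=
    PowerSeries.ext fun n => PowerSeries.coeff_mk n _
  simpa [conv_eq, mk_eq] using
    subst_changeVar_mk_freeMoment (κ := (PowerSeries.coeff · f.genusZeroSeries)) h0 0

theorem fstSeries_genusZeroSeries_flat (φ φ' : PSFun S) :
    fstSeries (flat φ φ').genusZeroSeries = φ.genusZeroSeries := by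
  ext n
  by_cases h : n = 0 <;> simp [genusZeroSeries, flat, h]

theorem sndSeries_genusZeroSeries_flat (φ φ' : PSFun S) :
    sndSeries (flat φ φ').genusZeroSeries = φ'.genusHalfSeries := by
  ext n
  by_cases h : n = 0 <;> simp [genusZeroSeries, genusHalfSeries, flat, h]

end PSFun

theorem mainTheorem6 {R : Type*} [CommRing R] (φ φ' φv φv' : PSFun R)
    (hφ : (PSFun.flat φ φ').IsMultiplicative) (hφv : (PSFun.flat φv φv').IsMultiplicative)
    (hconv : PSFun.flat φ φ' = PSFun.conv (PSFun.zeta (DualNumber R)) (PSFun.flat φv φv')) :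
    PowerSeries.subst (changeVar φv.genusZeroSeries) φ.genusZeroSeries = φv.genusZeroSeries ∧
    PowerSeries.subst (changeVar φv.genusZeroSeries) φ'.genusHalfSeries =
      logDerivRatio φv.genusZeroSeries * φv'.genusHalfSeries ∧
    ((PowerSeries.subst (changeVar φv.genusZeroSeries) φ'.genusHalfSeries : R⟦X⟧) :
        LaurentSeries R) * dlog (changeVar φv.genusZeroSeries) =
      (φv'.genusHalfSeries : LaurentSeries R) * dlog PowerSeries.X := by
  have relation := PSFun.subst_changeVar_genusZeroSeries_conv_zeta hφv
  rw [← hconv] at relation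
  have constantCoeff_eq := PSFun.constantCoeff_genusZeroSeries (PSFun.flat φv φv')
  have genusZero := MomentCumulant.fstSeries_subst_changeVar_of_subst_eq constantCoeff_eq relation
  have genusHalf := MomentCumulant.sndSeries_subst_changeVar_of_subst_eq constantCoeff_eq relation
  simp only [PSFun.fstSeries_genusZeroSeries_flat, PSFun.sndSeries_genusZeroSeries_flat]
    at genusZero genusHalf
  refine ⟨genusZero, genusHalf, ?_⟩
  rw [genusHalf, PowerSeries.coe_mul, mul_right_comm, mul_comm,
    logDerivRatio_mul_dlog _ (PSFun.constantCoeff_genusZeroSeries φv)]
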